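/- Let $d,N,M$ be natural numbers. Consider $N$ bosons in $\mathbb R^d$ with the Hamiltonian $$H=\sum_{j=1}^N\Big(-\tfrac12\Delta_j+V(\mathbf r_j)\Big)+\sum_{j<k}\Big(W(\mathbf r_j-\mathbf r_k)+g\,\delta(\mathbf r_j-\mathbf r_k)\Big),$$ where $V,W:\mathbb R^d\to\mathbb R$ and $g\in\mathbb R$ are arbitrary; $\langle\Phi|H|\Psi\rangle$ denotes the matrix element in the form sense (kinetic part $\tfrac12\langle\nabla\Phi|\nabla\Psi\rangle$, contact part $g\sum_{j<k}\int_{\mathbf r_j=\mathbf r_k}\Phi^*\Psi$), defined for bosonic $\Phi,\Psi$ in the form domain $Q$: weak gradient in $L^2$, integrable potential energies and, if $g\ne0$, a continuous representative whose restriction to each set $\mathbf r_j=\mathbf r_k$ is square integrable. For orbitals $\phi=(\phi_1,\dots,\phi_M)$ in $L^2(\mathbb R^d;\mathbb C)$ and coefficients $C_{\vec n}\in\mathbb C$, where $\vec n=(n_1,\dots,n_M)$ with $\sum_k n_k=N$, the MCTDHB ansatz is $$\Psi=\Psi(C,\phi)=\sum_{\vec n}C_{\vec n}|\vec n\rangle,\qquad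 |\vec n\rangle=\frac{b^\dagger(\phi_1)^{n_1}\cdots b^\dagger(\phi_M)^{n_M}}{\sqrt{n_1!\cdots n_M!}}|vac\rangle .$$ The set $\{\delta\Psi\}$ of allowed variations at $(C,\phi)$ consists of all derivatives $\frac{d}{ds}\Psi(C+s\,\delta C,\phi+s\,\delta\phi)\big|_{s=0}$, $s\in\mathbb R$, with arbitrary $\delta C$ and arbitrary $\delta\phi_1,\dots,\delta\phi_M\in L^2(\mathbb R^d;\mathbb C)$. For a (possibly unbounded) linear one-particle operator $a$ with domain $D(a)\subseteq L^2(\mathbb R^d;\mathbb C)$, the one-body operator $A=\sum_{j=1}^N a_j$ is defined on the span of the products $f_1\otimes\dots\otimes f_N$ with $f_i\in D(a)$. 1. Let $\phi_1,\dots,\phi_M$ be orthonormal. Then $\{\delta\Psi\}$ is a complex linear space and $$\{\delta\Psi\}=\operatorname{span}_{\mathbb C}\{|\vec n\rangle,\;A\Psi\},$$ where $\vec n$ runs over all occupation numbers and $A$ over all one-body operators $A=\sum_j a_j$ with $\phi_1,\dots,\phi_M\in D(a)$. In particular $\{\delta\Psi\}$ contains all permanents and all these vectors $A\Psi$. 2.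 Let $\phi_1,\dots,\phi_M$ be orthonormal and in $D(a)$. Then $\Psi$ is in the domain of $A=\sum_j a_j$, and for every orthonormal (Hilbert) basis $(e_q)$ of $L^2(\mathbb R^d;\mathbb C)$, $$A\Psi=\sum_q\sum_{k=1}^M a_{qk}\,b^\dagger(e_q)\,b(\phi_k)\Psi,\qquad a_{qk}=\langle e_q|a\phi_k\rangle .$$ 3. Let $I\subseteq\mathbb R$ be an interval and let $\Psi(t)=\Psi(C(t),\phi(t))$, $t\in I$, with orthonormal $\phi_1(t),\dots,\phi_M(t)$, satisfy the Dirac–Frenkel variational principle: $\Psi(t)\in Q$, $\Psi$ is differentiable in $L^2$ on $I$, and $$\langle\delta\Psi|\big(H-i\tfrac{\partial}{\partial t}\big)|\Psi(t)\rangle=0$$ for all $t\in I$ and all allowed variations $\delta\Psi\in Q$ at $(C(t),\phi(t))$. Let $a$ be a Hermitian one-particle operator whose one-body observable $A=\sum_j a_j$ commutes with $H$, i.e. $\langle A\Phi|H|\Psi'\rangle=\langle\Phi|H|A\Psi'\rangle$ for all $\Phi,\Psi'\in Q\cap D(A)$ with $A\Phi,A\Psi'\in Q$. Assume that $\phi_k(t)\in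 D(a)$ and $A\Psi(t)\in Q$ for all $t\in I$ and all $k$, and that $t\mapsto A\Psi(t)$ is continuous in $L^2$ on $I$. Then $$\frac{d}{dt}\langle\Psi(t)|A|\Psi(t)\rangle=0\quad\text{on } I,$$ and $\langle\Psi(t)|A|\Psi(t)\rangle$ is constant on $I$. This holds for every number $M$ of orbitals, in particular already for $M=1$ (the Gross–Pitaevskii ansatz). -/

import Mathlib

open MeasureTheory
open scoped ContDiff InnerProductSpace

noncomputable section

/-! ### Wave functions -/

/-- Position space of one particle in `d` dimensions. -/
abbrev Pos (d : ℕ) : Type := EuclideanSpace ℝ (Fin d)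

/-- Configurations `(r_1, …, r_N)` of `N` particles. -/
abbrev Config (d N : ℕ) : Type := Fin N → Pos d

/-- Orbitals: the one-particle Hilbert space `L²(ℝ^d; ℂ)`. -/
abbrev Orbital (d : ℕ) : Type := Lp ℂ 2 (volume : Measure (Pos d))

/-- The Hilbert space `L²((ℝ^d)^N; ℂ)` of `N`-particle wave functions. -/
abbrev WaveFun (d N : ℕ) : Type := Lp ℂ 2 (volume : Measure (Config d N))

/-- Bosonic wave functions: invariant under all permutations of the particles. -/
def IsBosonic {d N : ℕ} (Ψ : WaveFun d N) : Prop :=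
  ∀ σ : Equiv.Perm (Fin N), (fun r : Config d N => Ψ (fun i => r (σ i))) =ᵐ[volume] Ψ

/-! ### Products of wave functions, creation and annihilation operators -/

theorem memLp_mulProd {d N : ℕ} (f : Orbital d) (Ψ : WaveFun d N) :
    MemLp (fun p : Pos d × Config d N => f p.1 * Ψ p.2) 2 volume := by
  have hf := Lp.memLp f
  have hΨ := Lp.memLp Ψ
  have hm : AEStronglyMeasurable (fun p : Pos d × Config d N => f p.1 * Ψ p.2)
      ((volume : Measure (Pos d)).prod (volume : Measure (Config d N))) :=
    hf.1.comp_fst.mul hΨ.1.comp_snd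
  rw [Measure.volume_eq_prod]
  rw [memLp_two_iff_integrable_sq_norm hm]
  have h1 := (memLp_two_iff_integrable_sq_norm hf.1).1 hf
  have h2 := (memLp_two_iff_integrable_sq_norm hΨ.1).1 hΨ
  refine (h1.mul_prod h2).congr (Filter.Eventually.of_forall fun p => ?_)
  simp [mul_pow]

theorem norm_mulProd {d N : ℕ} (f : Orbital d) (Ψ : WaveFun d N) :
    ‖(memLp_mulProd f Ψ).toLp‖ = ‖f‖ * ‖Ψ‖ := by
  rw [Lp.norm_toLp, Lp.norm_def, Lp.norm_def, ← ENNReal.toReal_mul]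
  congr 1
  have h2 : (2 : ENNReal) ≠ 0 := by norm_num
  have h2' : (2 : ENNReal) ≠ ⊤ := by norm_num
  rw [eLpNorm_eq_lintegral_rpow_enorm_toReal h2 h2', eLpNorm_eq_lintegral_rpow_enorm_toReal h2 h2',
    eLpNorm_eq_lintegral_rpow_enorm_toReal h2 h2', ← ENNReal.mul_rpow_of_nonneg _ _ (by norm_num)]
  congr 1
  rw [Measure.volume_eq_prod, ← lintegral_prod_mul]
  · refine lintegral_congr fun p => ?_
    rw [enorm_mul, ENNReal.mul_rpow_of_nonneg _ _ (by norm_num)]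
  · exact (Lp.memLp f).1.enorm.pow_const _
  · exact (Lp.memLp Ψ).1.enorm.pow_const _

/-- `Ψ ↦ f ⊗ Ψ`, with `(f ⊗ Ψ)(r, R) = f(r) Ψ(R)`. -/
def mulProd {d N : ℕ} (f : Orbital d) :
    WaveFun d N →L[ℂ] Lp ℂ 2 (volume : Measure (Pos d × Config d N)) :=
  LinearMap.mkContinuous
    { toFun := fun Ψ => (memLp_mulProd f Ψ).toLp
      map_add' := fun Ψ Φ => by
        rw [← MemLp.toLp_add]
        refine MemLp.toLp_congr _ _ ?_
        have h := (Measure.quasiMeasurePreserving_snd (μ := (volume : Measure (Pos d)))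
          (ν := (volume : Measure (Config d N)))).ae_eq_comp (Lp.coeFn_add Ψ Φ)
        rw [Measure.volume_eq_prod]
        filter_upwards [h] with p hp
        simp only [Function.comp_apply, Pi.add_apply] at hp ⊢
        rw [hp, mul_add]
      map_smul' := fun c Ψ => by
        rw [RingHom.id_apply, ← MemLp.toLp_const_smul]
        refine MemLp.toLp_congr _ _ ?_
        have h := (Measure.quasiMeasurePreserving_snd (μ := (volume : Measure (Pos d)))
          (ν := (volume : Measure (Config d N)))).ae_eq_comp (Lp.coeFn_smul c Ψ)
        rw [Measure.volume_eq_prod]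
        filter_upwards [h] with p hp
        simp only [Function.comp_apply, Pi.smul_apply, smul_eq_mul] at hp ⊢
        rw [hp]; ring }
    ‖f‖ (fun Ψ => (norm_mulProd f Ψ).le)

/-- Put a new particle in the orbital `f`, as particle number `j`: the wave function
`r ↦ f(r_j) Ψ(r_1, …, r_j omitted, …, r_{N+1})`. -/
def insertOp {d N : ℕ} (j : Fin (N + 1)) (f : Orbital d) :
    WaveFun d N →L[ℂ] WaveFun d (N + 1) :=
  (Lp.compMeasurePreservingₗᵢ ℂ _
    (volume_preserving_piFinSuccAbove (fun _ : Fin (N + 1) => Pos d) j)).toContinuousLinearMap ∘L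
      mulProd f

theorem insertOp_coeFn {d N : ℕ} (j : Fin (N + 1)) (f : Orbital d) (Ψ : WaveFun d N) :
    insertOp j f Ψ =ᵐ[volume]
      fun r : Config d (N + 1) => f (r j) * Ψ (fun i => r (j.succAbove i)) := by
  have hmp := volume_preserving_piFinSuccAbove (fun _ : Fin (N + 1) => Pos d) j
  have h1 : insertOp j f Ψ =ᵐ[volume] _ :=
    Lp.coeFn_compMeasurePreserving ((memLp_mulProd f Ψ).toLp) hmp
  refine h1.trans ?_
  have h2 := hmp.quasiMeasurePreserving.ae_eq_comp (memLp_mulProd f Ψ).coeFn_toLp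
  exact h2

/-- The `N`-sector of the creation operator `b†(f)`:
`(b†(f)Ψ)(r_1,…,r_{N+1}) = (N+1)^{-1/2} ∑_j f(r_j) Ψ(r_1,…, r_j omitted, …,r_{N+1})`. -/
def creation {d N : ℕ} (f : Orbital d) : WaveFun d N →L[ℂ] WaveFun d (N + 1) :=
  ((Real.sqrt (N + 1) : ℂ))⁻¹ • ∑ j : Fin (N + 1), insertOp j f

/-- The annihilation operator `b(f)` is the adjoint of `b†(f)`. -/
def annihilation {d N : ℕ} (f : Orbital d) : WaveFun d (N + 1) →L[ℂ] WaveFun d N :=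
  ContinuousLinearMap.adjoint (creation f)

/-- Families `(Ψ_N)_N` of `N`-particle wave functions (only states with a definite particle
number, `Pi.single N Ψ`, are used, so no convergence condition is imposed). -/
abbrev Fock (d : ℕ) : Type := (N : ℕ) → WaveFun d N

/-- The vacuum vector: the constant function `1` of no variable. -/
def vac (d : ℕ) : Fock d := Pi.single 0 (Lp.const 2 volume (1 : ℂ))

/-- The creation operator `b†(f)` on all sectors. -/
def bDag {d : ℕ} (f : Orbital d) : Fock d →ₗ[ℂ] Fock d where
  toFun F := fun N => match N with
    | 0 => 0
    | n + 1 => creation f (F n)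
  map_add' F G := by
    funext N
    cases N <;> simp
  map_smul' c F := by
    funext N
    cases N <;> simp

/-- The annihilation operator `b(f)` on all sectors. -/
def bAnn {d : ℕ} (f : Orbital d) : Fock d →ₗ[ℂ] Fock d where
  toFun F := fun N => annihilation f (F (N + 1))
  map_add' F G := by
    funext N
    simp
  map_smul' c F := by
    funext N
    simp

/-! ### The MCTDHB ansatz and its variations -/

/-- The occupation numbers `n = (n_1, …, n_M)` with `n_1 + … + n_M = N`. -/
def occupations (M N : ℕ) : Finset (Fin M → ℕ) := Finset.piAntidiag Finset.univ N

/-- The permanent `|n⟩ = (n_1! ⋯ n_M!)^{-1/2} b_1†^{n_1} ⋯ b_M†^{n_M} |vac⟩` built from the orbitals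
`φ_1, …, φ_M`, as an `N`-particle wave function. -/
def permanent {d M : ℕ} (N : ℕ) (φ : Fin M → Orbital d) (n : Fin M → ℕ) : WaveFun d N :=
  (Real.sqrt (∏ k, ((n k).factorial : ℝ)) : ℂ)⁻¹ •
    ((List.ofFn fun k => (bDag (φ k) : Module.End ℂ (Fock d)) ^ n k).prod (vac d)) N

/-- The MCTDHB ansatz `Ψ = ∑_n C_n |n⟩`. -/
def ansatz {d M : ℕ} (N : ℕ) (C : (Fin M → ℕ) → ℂ) (φ : Fin M → Orbital d) : WaveFun d N :=
  ∑ n ∈ occupations M N, C n • permanent N φ n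

/-- The allowed variations `δΨ` of the ansatz at the parameters `(C, φ)`: the derivatives of the
ansatz wave function under arbitrary variations `C → C + s δC`, `φ → φ + s δφ` of its coefficients
and its orbitals. -/
def allowedVariations {d M : ℕ} (N : ℕ) (C : (Fin M → ℕ) → ℂ) (φ : Fin M → Orbital d) :
    Set (WaveFun d N) :=
  {δΨ | ∃ (δC : (Fin M → ℕ) → ℂ) (δφ : Fin M → Orbital d),
    HasDerivAt (fun s : ℝ => ansatz N (C + s • δC) (φ + s • δφ)) δΨ 0}

/-! ### One-body operators -/

/-- The product wave function `f_1(r_1) ⋯ f_N(r_N)`. -/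
def productState {d : ℕ} : (N : ℕ) → (Fin N → Orbital d) → WaveFun d N
  | 0, _ => Lp.const 2 volume (1 : ℂ)
  | N + 1, f => insertOp 0 (f 0) (productState N (fun i => f i.succ))

/-- The one-body operator `A = ∑_{j=1}^N a_j` of a (possibly unbounded, everywhere or partially
defined) one-particle operator `a`. Its domain is the span of the products `f_1 ⊗ ⋯ ⊗ f_N` of
orbitals in the domain of `a`, and `A (f_1 ⊗ ⋯ ⊗ f_N) = ∑_j f_1 ⊗ ⋯ ⊗ a f_j ⊗ ⋯ ⊗ f_N`. -/
def oneBody {d : ℕ} (N : ℕ) (a : Orbital d →ₗ.[ℂ] Orbital d) : WaveFun d N →ₗ.[ℂ] WaveFun d N :=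
  (Submodule.span ℂ {p : WaveFun d N × WaveFun d N | ∃ f : Fin N → a.domain,
    p = (productState N (fun i => (f i : Orbital d)),
      ∑ j, productState N (Function.update (fun i => (f i : Orbital d)) j (a (f j))))}).toLinearPMap

open Classical in
/-- The vector `T Ψ` (set to `0` when `Ψ` is not in the domain of `T`). -/
def applyOp {d N : ℕ} (T : WaveFun d N →ₗ.[ℂ] WaveFun d N) (Ψ : WaveFun d N) : WaveFun d N :=
  if h : Ψ ∈ T.domain then T ⟨Ψ, h⟩ else 0

/-- The expectation value `⟨Ψ|T|Ψ⟩`. -/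
def expectation {d N : ℕ} (T : WaveFun d N →ₗ.[ℂ] WaveFun d N) (Ψ : WaveFun d N) : ℂ :=
  ⟪Ψ, applyOp T Ψ⟫_ℂ

/-! ### The many-body Hamiltonian

`H = ∑_j (-Δ_j/2 + V(r_j)) + ∑_{j<k} (W(r_j - r_k) + g δ(r_j - r_k))`, through its matrix elements
`⟨Φ|H|Ψ⟩`. The regular interaction potential `W` and the contact interaction of strength `g` are
both included. -/

/-- The coordinate direction number `α` of particle `j` in configuration space. -/
def coordDir {d N : ℕ} (j : Fin N) (α : Fin d) : Config d N :=
  Pi.single j (EuclideanSpace.single α (1 : ℝ))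

/-- `G` is the weak partial derivative of `Ψ` in the direction `v`. -/
def HasWeakDeriv {d N : ℕ} (v : Config d N) (Ψ G : WaveFun d N) : Prop :=
  ∀ χ : Config d N → ℝ, ContDiff ℝ ∞ χ → HasCompactSupport χ →
    ∫ r, ((lineDeriv ℝ χ r v : ℝ) : ℂ) * Ψ r = - ∫ r, (χ r : ℂ) * G r

open Classical in
/-- The weak partial derivative in `L²` (set to `0` if there is none). -/
def weakDeriv {d N : ℕ} (v : Config d N) (Ψ : WaveFun d N) : WaveFun d N :=
  if h : ∃ G, HasWeakDeriv v Ψ G then h.choose else 0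

open Classical in
/-- The continuous representative of `Ψ` (set to `0` if there is none). -/
def contRep {d N : ℕ} (Ψ : WaveFun d N) : Config d N → ℂ :=
  if h : ∃ F : Config d N → ℂ, Continuous F ∧ Ψ =ᵐ[volume] F then h.choose else 0

/-- The configuration in which particle `k` sits at the position of particle `j` and the other
particles are at `y`. -/
def collide {d N : ℕ} (j k : Fin N) (y : {i : Fin N // i ≠ k} → Pos d) : Config d N := fun i =>
  if hi : i ≠ k then y ⟨i, hi⟩ else if hj : j ≠ k then y ⟨j, hj⟩ else 0

/-- The pairs `j < k` of particles. -/
def pairs (N : ℕ) : Finset (Fin N × Fin N) := Finset.univ.filter fun p => p.1 < p.2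

/-- The external and the regular interaction potential,
`∑_j V(r_j) + ∑_{j<k} W(r_j - r_k)`. -/
def potential {d N : ℕ} (V W : Pos d → ℝ) (r : Config d N) : ℝ :=
  ∑ j, V (r j) + ∑ p ∈ pairs N, W (r p.1 - r p.2)

/-- The matrix element `⟨Φ|H|Ψ⟩`; the kinetic energy is integrated by parts,
`⟨Φ|-Δ/2|Ψ⟩ = ⟨∇Φ|∇Ψ⟩/2`, and the contact interaction is integrated out,
`⟨Φ|δ(r_j - r_k)|Ψ⟩ = ∫ Φ^* Ψ` over the configurations with `r_j = r_k`. -/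
def energyForm {d N : ℕ} (V W : Pos d → ℝ) (g : ℝ) (Φ Ψ : WaveFun d N) : ℂ :=
  (1 / 2 : ℂ) * ∑ j : Fin N, ∑ α : Fin d,
      ⟪weakDeriv (coordDir j α) Φ, weakDeriv (coordDir j α) Ψ⟫_ℂ
    + ∫ r : Config d N, (potential V W r : ℂ) * (starRingEnd ℂ (Φ r) * Ψ r)
    + (g : ℂ) * ∑ p ∈ pairs N, ∫ y : {i : Fin N // i ≠ p.2} → Pos d,
        starRingEnd ℂ (contRep Φ (collide p.1 p.2 y)) * contRep Ψ (collide p.1 p.2 y)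

/-- The bosonic wave functions between which all terms of `⟨Φ|H|Ψ⟩` are well defined: the weak
gradient is in `L²`, the potential energies are integrable and, if there is a contact interaction,
the wave function is continuous with square integrable restriction to the sets `r_j = r_k`. -/
structure InFormDomain {d N : ℕ} (V W : Pos d → ℝ) (g : ℝ) (Ψ : WaveFun d N) : Prop where
  bosonic : IsBosonic Ψ
  kinetic : ∀ (j : Fin N) (α : Fin d), ∃ G, HasWeakDeriv (coordDir j α) Ψ G
  external : ∀ j : Fin N, Integrable fun r : Config d N => V (r j) * ‖Ψ r‖ ^ 2
  interaction : ∀ p ∈ pairs N, Integrable fun r : Config d N => W (r p.1 - r p.2) * ‖Ψ r‖ ^ 2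
  contact : g ≠ 0 → (∃ F : Config d N → ℂ, Continuous F ∧ Ψ =ᵐ[volume] F) ∧
    ∀ p ∈ pairs N, Integrable fun y : {i : Fin N // i ≠ p.2} → Pos d =>
      ‖contRep Ψ (collide p.1 p.2 y)‖ ^ 2

/-- `[H, T] = 0`, in the sense of matrix elements: `⟨TΦ|H|Ψ⟩ = ⟨Φ|H|TΨ⟩` whenever both sides are
defined. -/
def CommutesWithH {d N : ℕ} (V W : Pos d → ℝ) (g : ℝ) (T : WaveFun d N →ₗ.[ℂ] WaveFun d N) :
    Prop :=
  ∀ Φ Ψ : T.domain, InFormDomain V W g (Φ : WaveFun d N) → InFormDomain V W g (Ψ : WaveFun d N) →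
    InFormDomain V W g (T Φ) → InFormDomain V W g (T Ψ) →
    energyForm V W g (T Φ) Ψ = energyForm V W g Φ (T Ψ)

/-- The Dirac-Frenkel variational principle on the time interval `I`: `Ψ(t) = ∑_n C_n(t)|n;t⟩` is
differentiable in `L²` and `⟨δΨ|(H - i∂/∂t)|Ψ⟩ = 0` for every allowed variation `δΨ` (for which
`⟨δΨ|H|Ψ⟩` is defined). -/
def DiracFrenkel {d M : ℕ} (N : ℕ) (V W : Pos d → ℝ) (g : ℝ) (I : Set ℝ)
    (C : ℝ → (Fin M → ℕ) → ℂ) (φ : ℝ → Fin M → Orbital d) : Prop :=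
  ∀ t ∈ I, InFormDomain V W g (ansatz N (C t) (φ t)) ∧
    ∃ Ψ' : WaveFun d N, HasDerivWithinAt (fun s => ansatz N (C s) (φ s)) Ψ' I t ∧
      ∀ δΨ ∈ allowedVariations N (C t) (φ t), InFormDomain V W g δΨ →
        energyForm V W g δΨ (ansatz N (C t) (φ t)) - Complex.I * ⟪δΨ, Ψ'⟫_ℂ = 0

end

/-! ### Insertion of a particle -/

/-! Everything reduces to the bounded operators `excitation φ g N`, the one-body operators of `∑ k,
|g_k⟩⟨φ_k|`. For orthonormal `φ` this one-particle operator sends `φ_k` to `g_k`, and a permanent is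
a multiple of a symmetrized product of the `φ_k`. So two things coincide on `Ψ`: the Leibniz rule
along `φ + s g` (`hasDerivAt_permanent`) and the action of any `A = ∑ a_j` with `a φ_k = g_k`
(`applyOp_oneBody_ansatz`). Variations are therefore exactly the vectors `ansatz N δC φ + excitation
φ δφ N Ψ`, linear in `(δC, δφ)`; `AΨ` is the one with `δC = 0`, `δφ_k = a φ_k`, and every `δφ`
arises from a finite rank `a`. On symmetric states the excitation is `∑ k, b†(g_k) b(φ_k)`, and
expanding `g_k` in a Hilbert basis gives the second-quantized formula.

For the conservation law, insert `δΨ = AΨ` into Dirac-Frenkel: `⟨AΨ|H|Ψ⟩ = i⟨AΨ|Ψ'⟩`. Commutation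
and hermiticity of the energy form make the left side real, so `Re ⟨AΨ|Ψ'⟩ = 0`; twice this real
part is the derivative of `⟨Ψ|A|Ψ⟩`. -/

theorem quasiMeasurePreserving_comp_succAbove {d N : ℕ} (j : Fin (N + 1)) :
    Measure.QuasiMeasurePreserving
      (fun r : Config d (N + 1) => (fun i => r (j.succAbove i) : Config d N)) volume volume :=
  (Measure.quasiMeasurePreserving_snd (μ := (volume : Measure (Pos d)))
    (ν := (volume : Measure (Config d N)))).comp
      (volume_preserving_piFinSuccAbove (fun _ : Fin (N + 1) => Pos d) j).quasiMeasurePreserving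

theorem insertOp_add {d N : ℕ} (j : Fin (N + 1)) (f g : Orbital d) (Ψ : WaveFun d N) :
    insertOp j (f + g) Ψ = insertOp j f Ψ + insertOp j g Ψ := by
  apply Lp.ext
  have h := (Measure.quasiMeasurePreserving_eval (fun _ : Fin (N + 1) => (volume : Measure (Pos d)))
    j).ae_eq_comp (Lp.coeFn_add f g)
  filter_upwards [insertOp_coeFn j (f + g) Ψ, insertOp_coeFn j f Ψ, insertOp_coeFn j g Ψ,
    Lp.coeFn_add (insertOp j f Ψ) (insertOp j g Ψ), h] with r h1 h2 h3 h4 h5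
  simp only [Function.comp_apply, Function.eval, Pi.add_apply] at h5
  rw [h1, h4, Pi.add_apply, h2, h3, h5, add_mul]

theorem insertOp_smul {d N : ℕ} (j : Fin (N + 1)) (c : ℂ) (f : Orbital d) (Ψ : WaveFun d N) :
    insertOp j (c • f) Ψ = c • insertOp j f Ψ := by
  apply Lp.ext
  have h := (Measure.quasiMeasurePreserving_eval (fun _ : Fin (N + 1) => (volume : Measure (Pos d)))
    j).ae_eq_comp (Lp.coeFn_smul c f)
  filter_upwards [insertOp_coeFn j (c • f) Ψ, insertOp_coeFn j f Ψ,
    Lp.coeFn_smul c (insertOp j f Ψ), h] with r h1 h2 h4 h5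
  simp only [Function.comp_apply, Function.eval, Pi.smul_apply, smul_eq_mul] at h5
  rw [h1, h4, Pi.smul_apply, h2, h5, smul_eq_mul, mul_assoc]

theorem norm_insertOp_apply {d N : ℕ} (j : Fin (N + 1)) (f : Orbital d) (Ψ : WaveFun d N) :
    ‖insertOp j f Ψ‖ = ‖f‖ * ‖Ψ‖ := by
  rw [← norm_mulProd f Ψ]
  exact LinearIsometry.norm_map (Lp.compMeasurePreservingₗᵢ ℂ _
    (volume_preserving_piFinSuccAbove (fun _ : Fin (N + 1) => Pos d) j)) _

/-- The bilinear map `(f, Ψ) ↦ insertOp j f Ψ`. -/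
noncomputable def insertL {d N : ℕ} (j : Fin (N + 1)) :
    Orbital d →L[ℂ] WaveFun d N →L[ℂ] WaveFun d (N + 1) :=
  LinearMap.mkContinuous
    { toFun := fun f => insertOp j f
      map_add' := fun f g => ContinuousLinearMap.ext fun Ψ => insertOp_add j f g Ψ
      map_smul' := fun c f => ContinuousLinearMap.ext fun Ψ => insertOp_smul j c f Ψ }
    1 (fun f => ContinuousLinearMap.opNorm_le_bound _ (by positivity) fun Ψ => by
      rw [one_mul]; exact (norm_insertOp_apply j f Ψ).le)

theorem insertL_apply {d N : ℕ} (j : Fin (N + 1)) (f : Orbital d) :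
    insertL (N := N) j f = insertOp j f := rfl

theorem inner_insertOp {d N : ℕ} (j : Fin (N + 1)) (e f : Orbital d) (Φ Ψ : WaveFun d N) :
    ⟪insertOp j e Φ, insertOp j f Ψ⟫_ℂ = ⟪e, f⟫_ℂ * ⟪Φ, Ψ⟫_ℂ := by
  have h : ⟪insertOp j e Φ, insertOp j f Ψ⟫_ℂ = ⟪mulProd e Φ, mulProd f Ψ⟫_ℂ := by
    let U := Lp.compMeasurePreservingₗᵢ (E := ℂ) (p := 2) ℂ _
      (volume_preserving_piFinSuccAbove (fun _ : Fin (N + 1) => Pos d) j)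
    exact U.inner_map_map (mulProd e Φ) (mulProd f Ψ)
  rw [h, L2.inner_def, L2.inner_def, L2.inner_def, ← integral_prod_mul,
    ← Measure.volume_eq_prod]
  refine integral_congr_ae ?_
  filter_upwards [(memLp_mulProd e Φ).coeFn_toLp, (memLp_mulProd f Ψ).coeFn_toLp] with p h1 h2
  have h1' : mulProd e Φ p = e p.1 * Φ p.2 := h1
  have h2' : mulProd f Ψ p = f p.1 * Ψ p.2 := h2
  rw [h1', h2']
  simp only [RCLike.inner_apply, map_mul]
  ring

theorem adjoint_insertOp_insertOp {d N : ℕ} (j : Fin (N + 1)) (e f : Orbital d)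
    (Ψ : WaveFun d N) :
    ContinuousLinearMap.adjoint (insertOp j e) (insertOp j f Ψ) = ⟪e, f⟫_ℂ • Ψ := by
  refine ext_inner_left ℂ fun Φ => ?_
  rw [ContinuousLinearMap.adjoint_inner_right, inner_insertOp, inner_smul_right]

/-! ### Product states -/

theorem productState_coeFn {d : ℕ} : ∀ (N : ℕ) (f : Fin N → Orbital d),
    productState N f =ᵐ[volume] fun r : Config d N => ∏ i, f i (r i)
  | 0, f => by
    refine (Lp.coeFn_const (p := 2) (μ := (volume : Measure (Config d 0))) (1 : ℂ)).trans ?_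
    exact Filter.Eventually.of_forall fun r => by simp
  | N + 1, f => by
    refine (insertOp_coeFn 0 (f 0) (productState N fun i => f i.succ)).trans ?_
    filter_upwards [(quasiMeasurePreserving_comp_succAbove 0).ae_eq_comp
      (productState_coeFn N fun i => f i.succ)] with r hr
    simp only [Function.comp_apply] at hr
    rw [hr, Fin.prod_univ_succ]
    simp

/-- The recursion defining `productState` singles out slot `0`; by the pointwise product formula any
slot may be split off instead. -/
theorem productState_eq_insertOp {d N : ℕ} (j : Fin (N + 1)) (f : Fin (N + 1) → Orbital d) :
    productState (N + 1) f = insertOp j (f j) (productState N fun i => f (j.succAbove i)) := by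
  apply Lp.ext
  filter_upwards [productState_coeFn (N + 1) f,
    insertOp_coeFn j (f j) (productState N fun i => f (j.succAbove i)),
    (quasiMeasurePreserving_comp_succAbove j).ae_eq_comp
      (productState_coeFn N fun i => f (j.succAbove i))] with r h1 h2 h3
  simp only [Function.comp_apply] at h3
  rw [h1, h2, h3, Fin.prod_univ_succAbove _ j]

theorem productState_update {d N : ℕ} (j : Fin (N + 1)) (f : Fin (N + 1) → Orbital d)
    (g : Orbital d) :
    productState (N + 1) (Function.update f j g) =
      insertOp j g (productState N fun i => f (j.succAbove i)) := by
  rw [productState_eq_insertOp j]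
  simp

theorem inner_productState {d : ℕ} : ∀ (N : ℕ) (f g : Fin N → Orbital d),
    ⟪productState N f, productState N g⟫_ℂ = ∏ i, ⟪f i, g i⟫_ℂ
  | 0, f, g => by
    rw [L2.inner_def]
    have h : ∀ f : Fin 0 → Orbital d, ∀ᵐ r, productState 0 f r = 1 := fun f =>
      (productState_coeFn 0 f).trans (Filter.Eventually.of_forall fun r => by simp)
    rw [integral_congr_ae (g := fun _ => (1 : ℂ))]
    · simp [Measure.real, volume_pi]
    · filter_upwards [h f, h g] with r h1 h2
      simp [h1, h2]
  | N + 1, f, g => by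
    rw [productState, productState, inner_insertOp, inner_productState, Fin.prod_univ_succ]

/-- Leibniz rule, by induction on the number of factors from the bilinearity of insertion. -/
theorem hasDerivAt_productState {d : ℕ} : ∀ (N : ℕ) (f g : Fin N → Orbital d),
    HasDerivAt (fun z : ℂ => productState N (fun i => f i + z • g i))
      (∑ j, productState N (Function.update f j (g j))) 0
  | 0, f, g => by simpa [productState] using hasDerivAt_const (0 : ℂ) (productState 0 f)
  | N + 1, f, g => by
    have h1 : HasDerivAt (fun z : ℂ => f 0 + z • g 0) (g 0) 0 := by
      simpa using ((hasDerivAt_id (0 : ℂ)).smul_const (g 0)).const_add (f 0)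
    have h2 := hasDerivAt_productState N (fun i => f i.succ) (fun i => g i.succ)
    have h := ContinuousLinearMap.hasDerivAt_of_bilinear (B := insertL (N := N) 0)
      (fun _ => h1) (fun _ => h2)
    refine (h.congr_deriv ?_)
    simp only [zero_smul, add_zero, insertL_apply]
    refine (add_comm _ _).trans (Eq.trans ?_ (Fin.sum_univ_succ _).symm)
    rw [map_sum]
    congr 1
    refine Finset.sum_congr rfl fun j _ => ?_
    rw [productState, Function.update_of_ne (Fin.succ_ne_zero j).symm]
    congr 2
    funext i
    exact (congrFun (Fin.tail_update_succ f j (g j.succ)) i).symm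

/-! ### The bounded one-body operators `∑_j ∑_k |g_k⟩⟨φ_k|_j` -/

/-- The one-body operator of the finite rank one-particle operator `∑_k |g_k⟩⟨φ_k|`. -/
noncomputable def excitation {d M : ℕ} (φ g : Fin M → Orbital d) :
    (N : ℕ) → WaveFun d N →L[ℂ] WaveFun d N
  | 0 => 0
  | _ + 1 => ∑ j, ∑ k, insertOp j (g k) ∘L ContinuousLinearMap.adjoint (insertOp j (φ k))

theorem excitation_productState {d M : ℕ} (φ g : Fin M → Orbital d) :
    ∀ (N : ℕ) (f : Fin N → Orbital d), excitation φ g N (productState N f) =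
      ∑ j, productState N (Function.update f j (∑ k, ⟪φ k, f j⟫_ℂ • g k))
  | 0, f => by simp [excitation]
  | N + 1, f => by
    simp only [excitation, _root_.sum_apply, ContinuousLinearMap.comp_apply]
    refine Finset.sum_congr rfl fun j _ => ?_
    rw [productState_update, ← insertL_apply, map_sum, _root_.sum_apply]
    refine Finset.sum_congr rfl fun k _ => ?_
    rw [productState_eq_insertOp j, adjoint_insertOp_insertOp]
    simp [insertL_apply]

theorem excitation_add {d M : ℕ} (φ g g' : Fin M → Orbital d) :
    ∀ (N : ℕ) (Ψ : WaveFun d N),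
      excitation φ (g + g') N Ψ = excitation φ g N Ψ + excitation φ g' N Ψ
  | 0, Ψ => by simp [excitation]
  | N + 1, Ψ => by
    simp [excitation, insertOp_add, Finset.sum_add_distrib]

theorem excitation_smul {d M : ℕ} (φ g : Fin M → Orbital d) (c : ℂ) :
    ∀ (N : ℕ) (Ψ : WaveFun d N), excitation φ (c • g) N Ψ = c • excitation φ g N Ψ
  | 0, Ψ => by simp [excitation]
  | N + 1, Ψ => by
    simp [excitation, insertOp_smul, Finset.smul_sum]

/-! ### One-body operators of unbounded operators -/

/-- The span of the pairs `(f_1 ⊗ ⋯ ⊗ f_N, ∑_j f_1 ⊗ ⋯ ⊗ a f_j ⊗ ⋯ ⊗ f_N)`, `f_i ∈ D(a)`. -/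
noncomputable def oneBodyGraph {d : ℕ} (N : ℕ) (a : Orbital d →ₗ.[ℂ] Orbital d) :
    Submodule ℂ (WaveFun d N × WaveFun d N) :=
  Submodule.span ℂ {p : WaveFun d N × WaveFun d N | ∃ f : Fin N → a.domain,
    p = (productState N (fun i => (f i : Orbital d)),
      ∑ j, productState N (Function.update (fun i => (f i : Orbital d)) j (a (f j))))}

theorem sum_inner_smul_of_mem_span {E : Type*} [NormedAddCommGroup E] [InnerProductSpace ℂ E]
    {M : ℕ} {φ : Fin M → E} (hφ : Orthonormal ℂ φ) {x : E}
    (hx : x ∈ Submodule.span ℂ (Set.range φ)) : ∑ k, ⟪φ k, x⟫_ℂ • φ k = x := by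
  obtain ⟨c, rfl⟩ := (Submodule.mem_span_range_iff_exists_fun ℂ).1 hx
  exact Finset.sum_congr rfl fun k _ => by rw [hφ.inner_right_fintype]

theorem excitation_productState_of_mem_span {d M N : ℕ} (a : Orbital d →ₗ.[ℂ] Orbital d)
    (φ : Fin M → a.domain) (hφ : Orthonormal ℂ fun k => (φ k : Orbital d)) (f : Fin N → a.domain)
    (hf : ∀ i, (f i : Orbital d) ∈ Submodule.span ℂ (Set.range fun k => (φ k : Orbital d))) :
    excitation (fun k => (φ k : Orbital d)) (fun k => a (φ k)) N
        (productState N fun i => (f i : Orbital d)) =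
      ∑ j, productState N (Function.update (fun i => (f i : Orbital d)) j (a (f j))) := by
  rw [excitation_productState]
  refine Finset.sum_congr rfl fun j _ => ?_
  have h : f j = ∑ k, ⟪(φ k : Orbital d), f j⟫_ℂ • φ k := by
    apply Subtype.ext
    rw [Submodule.coe_sum]
    simpa using (sum_inner_smul_of_mem_span hφ (hf j)).symm
  have h' : a (f j) = ∑ k, ⟪(φ k : Orbital d), f j⟫_ℂ • a (φ k) := by
    conv_lhs => rw [h]
    rw [← LinearPMap.toFun_eq_coe, map_sum]
    simp only [map_smul]
    rfl
  rw [h']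

/-- A vector in the graph involves only finitely many orbitals, and on their span `F` the unbounded
`a` agrees with a finite rank operator. Allowing every orthonormal family whose span contains `F`
lets two graph vectors be treated with a common family, which closes the induction under addition.
-/
theorem exists_finiteDimensional_of_mem_oneBodyGraph {d N : ℕ} (a : Orbital d →ₗ.[ℂ] Orbital d)
    {x : WaveFun d N × WaveFun d N} (hx : x ∈ oneBodyGraph N a) :
    ∃ F : Submodule ℂ (Orbital d), FiniteDimensional ℂ F ∧ F ≤ a.domain ∧
      ∀ (M : ℕ) (φ : Fin M → a.domain), (Orthonormal ℂ fun k => (φ k : Orbital d)) →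
        F ≤ Submodule.span ℂ (Set.range fun k => (φ k : Orbital d)) →
        x.2 = excitation (fun k => (φ k : Orbital d)) (fun k => a (φ k)) N x.1 := by
  induction hx using Submodule.span_induction with
  | mem x hx =>
    obtain ⟨f, rfl⟩ := hx
    refine ⟨Submodule.span ℂ (Set.range fun i => (f i : Orbital d)),
      FiniteDimensional.span_of_finite ℂ (Set.finite_range _),
      Submodule.span_le.2 (Set.range_subset_iff.2 fun i => (f i).2), fun M φ hφ hF => ?_⟩
    exact (excitation_productState_of_mem_span a φ hφ f
      fun i => hF (Submodule.subset_span ⟨i, rfl⟩)).symm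
  | zero => exact ⟨⊥, inferInstance, bot_le, fun M φ _ _ => by simp⟩
  | add x y _ _ hx hy =>
    obtain ⟨F, hF, hFa, h⟩ := hx
    obtain ⟨G, hG, hGa, h'⟩ := hy
    refine ⟨F ⊔ G, inferInstance, sup_le hFa hGa, fun M φ hφ hs => ?_⟩
    rw [Prod.snd_add, Prod.fst_add, map_add, h M φ hφ (le_sup_left.trans hs),
      h' M φ hφ (le_sup_right.trans hs)]
  | smul c x _ hx =>
    obtain ⟨F, hF, hFa, h⟩ := hx
    refine ⟨F, hF, hFa, fun M φ hφ hs => ?_⟩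
    rw [Prod.smul_snd, Prod.smul_fst, map_smul, h M φ hφ hs]

/-- Well-definedness of `∑ a_j`: a product expansion is not unique, and `toLinearPMap` has the
intended graph only if that graph is single-valued. It is, since the second component is a linear
operator applied to the first. -/
theorem snd_eq_zero_of_mem_oneBodyGraph {d N : ℕ} (a : Orbital d →ₗ.[ℂ] Orbital d) :
    ∀ x ∈ oneBodyGraph N a, x.1 = 0 → x.2 = 0 := by
  intro x hx h0
  obtain ⟨F, hF, hFa, h⟩ := exists_finiteDimensional_of_mem_oneBodyGraph a hx
  have hb := (stdOrthonormalBasis ℂ F).orthonormal.comp_linearIsometry F.subtypeₗᵢ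
  rw [h _ (fun k => ⟨stdOrthonormalBasis ℂ F k, hFa (stdOrthonormalBasis ℂ F k).2⟩) hb, h0,
    map_zero]
  intro y hy
  have := (stdOrthonormalBasis ℂ F).sum_repr ⟨y, hy⟩
  rw [show y = ((⟨y, hy⟩ : F) : Orbital d) from rfl, ← this, Submodule.coe_sum]
  exact Submodule.sum_mem _ fun k _ => by
    rw [Submodule.coe_smul]
    exact Submodule.smul_mem _ _ (Submodule.subset_span ⟨k, rfl⟩)

theorem oneBody_graph {d N : ℕ} (a : Orbital d →ₗ.[ℂ] Orbital d) :
    (oneBody N a).graph = oneBodyGraph N a :=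
  Submodule.toLinearPMap_graph_eq _ (snd_eq_zero_of_mem_oneBodyGraph a)

theorem applyOp_of_mem_graph {d N : ℕ} (T : WaveFun d N →ₗ.[ℂ] WaveFun d N) {Ψ Φ : WaveFun d N}
    (h : (Ψ, Φ) ∈ T.graph) : Ψ ∈ T.domain ∧ applyOp T Ψ = Φ := by
  obtain ⟨y, hy, hy'⟩ := (LinearPMap.mem_graph_iff T).1 h
  simp only at hy hy'
  subst hy
  refine ⟨y.2, ?_⟩
  rw [applyOp, dif_pos y.2, ← hy']

/-- By sesquilinearity it suffices to compare two products, where inner products factorize and `a`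
is moved across within slot `j`. -/
theorem isFormalAdjoint_oneBody {d N : ℕ} {a : Orbital d →ₗ.[ℂ] Orbital d}
    (ha : a.IsFormalAdjoint a) : (oneBody N a).IsFormalAdjoint (oneBody N a) := by
  have key : ∀ x ∈ oneBodyGraph N a, ∀ y ∈ oneBodyGraph N a, ⟪x.2, y.1⟫_ℂ = ⟪x.1, y.2⟫_ℂ := by
    intro x hx y hy
    induction hx using Submodule.span_induction with
    | zero => simp
    | add x x' _ _ h h' => simp only [Prod.fst_add, Prod.snd_add, inner_add_left, h, h']
    | smul c x _ h => simp only [Prod.smul_fst, Prod.smul_snd, inner_smul_left, h]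
    | mem x hx =>
      obtain ⟨f, rfl⟩ := hx
      induction hy using Submodule.span_induction with
      | zero => simp
      | add x x' _ _ h h' => simp only [Prod.fst_add, Prod.snd_add, inner_add_right, h, h']
      | smul c x _ h => simp only [Prod.smul_fst, Prod.smul_snd, inner_smul_right, h]
      | mem y hy =>
        obtain ⟨g, rfl⟩ := hy
        simp only [sum_inner, inner_sum, inner_productState]
        refine Finset.sum_congr rfl fun j _ => Finset.prod_congr rfl fun i _ => ?_
        rcases eq_or_ne i j with rfl | h
        · simpa using ha (f i) (g i)
        · rw [Function.update_of_ne h, Function.update_of_ne h]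
  intro x y
  have hx := LinearPMap.mem_graph (oneBody N a) x
  have hy := LinearPMap.mem_graph (oneBody N a) y
  rw [oneBody_graph] at hx hy
  exact key _ hx _ hy

/-! ### Symmetrized products -/

/-- The symmetrized product `∑_σ f_{σ 1} ⊗ ⋯ ⊗ f_{σ N}`. -/
noncomputable def symProd {d : ℕ} (N : ℕ) (f : Fin N → Orbital d) : WaveFun d N :=
  ∑ σ : Equiv.Perm (Fin N), productState N fun i => f (σ i)

/-- The permutations of `N + 1` letters: `j ↦ 0` and `j.succAbove i ↦ (σ i).succ`. -/
noncomputable def permInsert {N : ℕ} (p : Fin (N + 1) × Equiv.Perm (Fin N)) :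
    Equiv.Perm (Fin (N + 1)) :=
  Equiv.Perm.decomposeFin.symm (0, p.2) * p.1.cycleRange

theorem permInsert_self {N : ℕ} (j : Fin (N + 1)) (σ : Equiv.Perm (Fin N)) :
    permInsert (j, σ) j = 0 := by
  simp [permInsert, Fin.cycleRange_self]

theorem permInsert_succAbove {N : ℕ} (j : Fin (N + 1)) (σ : Equiv.Perm (Fin N)) (i : Fin N) :
    permInsert (j, σ) (j.succAbove i) = (σ i).succ := by
  simp [permInsert, Fin.cycleRange_succAbove]

/-- This splits a sum over permutations of `N + 1` letters by the slot that is sent to `0`. -/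
theorem permInsert_bijective (N : ℕ) : Function.Bijective (permInsert (N := N)) := by
  rw [Fintype.bijective_iff_injective_and_card]
  constructor
  · rintro ⟨j, σ⟩ ⟨j', σ'⟩ h
    have hj : j = j' := by
      apply (permInsert (j', σ')).injective
      rw [permInsert_self, ← h, permInsert_self]
    subst hj
    congr 1
    ext i : 1
    apply Fin.succ_injective
    rw [← permInsert_succAbove j σ, ← permInsert_succAbove j σ', h]
  · simp [Fintype.card_perm, Nat.factorial_succ]

theorem creation_symProd {d N : ℕ} (g : Orbital d) (f : Fin N → Orbital d) :
    creation g (symProd N f) =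
      ((Real.sqrt (N + 1) : ℂ))⁻¹ • symProd (N + 1) (Fin.cons g f) := by
  rw [creation, _root_.smul_apply, _root_.sum_apply, symProd, symProd,
    ← (permInsert_bijective N).sum_comp, Fintype.sum_prod_type]
  congr 1
  refine Finset.sum_congr rfl fun j _ => ?_
  rw [map_sum]
  refine Finset.sum_congr rfl fun σ _ => ?_
  rw [productState_eq_insertOp j]
  simp only [permInsert_self, permInsert_succAbove, Fin.cons_zero, Fin.cons_succ]

theorem adjoint_insertOp_symProd {d N : ℕ} (j : Fin (N + 1)) (e : Orbital d)
    (f : Fin (N + 1) → Orbital d) :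
    ContinuousLinearMap.adjoint (insertOp j e) (symProd (N + 1) f) =
      ContinuousLinearMap.adjoint (insertOp 0 e) (symProd (N + 1) f) := by
  simp only [symProd, map_sum]
  -- Replacing `σ` by `σ * j.cycleRange` moves the letter in slot `j` to slot `0` and keeps the
  -- order of the others.
  rw [← Equiv.sum_comp (Equiv.mulRight j.cycleRange)]
  refine Finset.sum_congr rfl fun σ _ => ?_
  rw [productState_eq_insertOp j, productState_eq_insertOp 0, adjoint_insertOp_insertOp,
    adjoint_insertOp_insertOp]
  simp [Fin.cycleRange_self, Fin.cycleRange_succAbove]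

/-- By symmetry the `N + 1` slot contractions in `annihilation e` are equal, and this factor `N + 1`
cancels the two normalizations `(N + 1)^{-1/2}`. -/
theorem creation_annihilation_symProd {d N : ℕ} (g e : Orbital d) (f : Fin (N + 1) → Orbital d) :
    creation g (annihilation e (symProd (N + 1) f)) =
      ∑ j, insertOp j g (ContinuousLinearMap.adjoint (insertOp j e) (symProd (N + 1) f)) := by
  have hN : (0 : ℝ) ≤ N + 1 := by positivity
  have h : annihilation e (symProd (N + 1) f) = (((Real.sqrt (N + 1) : ℂ))⁻¹ * (N + 1)) •
      ContinuousLinearMap.adjoint (insertOp 0 e) (symProd (N + 1) f) := by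
    rw [annihilation, creation, map_smulₛₗ, map_sum, _root_.smul_apply,
      _root_.sum_apply, Finset.sum_congr rfl fun j _ => adjoint_insertOp_symProd j e f,
      Finset.sum_const, Finset.card_univ, Fintype.card_fin, mul_smul]
    congr 1
    · simp
    · rw [← Nat.cast_smul_eq_nsmul ℂ]; simp
  rw [h, map_smul, creation, _root_.smul_apply, smul_smul, _root_.sum_apply]
  have hc : ((Real.sqrt (N + 1) : ℂ))⁻¹ * (N + 1) * ((Real.sqrt (N + 1) : ℂ))⁻¹ = 1 := by
    have h2 : (Real.sqrt (N + 1) : ℂ) * (Real.sqrt (N + 1) : ℂ) = N + 1 := by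
      rw [← Complex.ofReal_mul, Real.mul_self_sqrt hN]; simp
    have h0 : (Real.sqrt (N + 1) : ℂ) ≠ 0 := by
      rw [Complex.ofReal_ne_zero]; positivity
    rw [← h2]
    field_simp
  rw [hc, one_smul]
  exact Finset.sum_congr rfl fun j _ => by rw [adjoint_insertOp_symProd j]

theorem sum_creation_annihilation_symProd {d M N : ℕ} (φ g : Fin M → Orbital d)
    (f : Fin (N + 1) → Orbital d) :
    ∑ k, creation (g k) (annihilation (φ k) (symProd (N + 1) f)) =
      excitation φ g (N + 1) (symProd (N + 1) f) := by
  simp only [creation_annihilation_symProd, excitation, _root_.sum_apply,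
    ContinuousLinearMap.comp_apply]
  exact Finset.sum_comm

/-! ### Permanents -/

theorem bDag_single {d N : ℕ} (f : Orbital d) (Ψ : WaveFun d N) :
    bDag f (Pi.single N Ψ) = Pi.single (N + 1) (creation f Ψ) := by
  funext m
  cases m with
  | zero => simp [bDag]
  | succ m =>
    rcases eq_or_ne m N with rfl | h
    · simp [bDag]
    · have h' : m + 1 ≠ N + 1 := by omega
      simp [bDag, Pi.single_eq_of_ne h, Pi.single_eq_of_ne h']

theorem exists_list_prod_bDag_vac {d M : ℕ} (l : List (Fin M)) :
    ∃ c : ℂ, ∀ φ : Fin M → Orbital d,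
      (l.map fun k => (bDag (φ k) : Module.End ℂ (Fock d))).prod (vac d) =
        Pi.single l.length (c • symProd l.length fun i => φ (l.get i)) := by
  induction l with
  | nil =>
    refine ⟨1, fun φ => ?_⟩
    simp [vac, symProd, productState]
  | cons k l ih =>
    obtain ⟨c, hc⟩ := ih
    refine ⟨c * ((Real.sqrt (l.length + 1) : ℂ))⁻¹, fun φ => ?_⟩
    rw [List.map_cons, List.prod_cons, Module.End.mul_apply, hc, bDag_single, map_smul,
      creation_symProd, smul_smul]
    have h : (Fin.cons (φ k) fun i => φ (l.get i) : Fin (l.length + 1) → Orbital d) =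
        fun i => φ ((k :: l).get i) := by
      funext i
      refine Fin.cases ?_ (fun i => ?_) i <;> simp
    rw [h]
    rfl

/-- The constant and the labelling must not depend on `φ`: the identity is differentiated in the
orbitals later. -/
theorem exists_permanent_eq {d M N : ℕ} {n : Fin M → ℕ} (hn : n ∈ occupations M N) :
    ∃ (c : ℂ) (κ : Fin N → Fin M), ∀ φ : Fin M → Orbital d,
      permanent N φ n = c • symProd N fun i => φ (κ i) := by
  have hn' : ∑ k, n k = N := by
    simpa [occupations] using hn
  -- The word in which the letter `k` is repeated `n k` times; its letters are `κ`.
  set l : List (Fin M) := (List.ofFn fun k => List.replicate (n k) k).flatten with hl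
  have hlen : l.length = N := by
    rw [hl, List.length_flatten, List.map_ofFn, List.sum_ofFn, ← hn']
    simp
  have hprod : ∀ φ : Fin M → Orbital d,
      (List.ofFn fun k => (bDag (φ k) : Module.End ℂ (Fock d)) ^ n k).prod =
        (l.map fun k => (bDag (φ k) : Module.End ℂ (Fock d))).prod := by
    intro φ
    rw [hl, List.map_flatten, List.prod_flatten, List.map_ofFn, List.map_ofFn]
    congr 2
    funext k
    simp
  clear_value l
  subst hlen
  obtain ⟨c, hc⟩ := exists_list_prod_bDag_vac (d := d) l
  refine ⟨(Real.sqrt (∏ k, ((n k).factorial : ℝ)) : ℂ)⁻¹ * c, l.get, fun φ => ?_⟩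
  rw [permanent, hprod, hc, Pi.single_eq_same, smul_smul]

theorem excitation_symProd {d M N : ℕ} {φ : Fin M → Orbital d} (hφ : Orthonormal ℂ φ)
    (g : Fin M → Orbital d) (κ : Fin N → Fin M) :
    excitation φ g N (symProd N fun i => φ (κ i)) =
      ∑ σ : Equiv.Perm (Fin N), ∑ j,
        productState N (Function.update (fun i => φ (κ (σ i))) j (g (κ (σ j)))) := by
  rw [symProd, map_sum]
  refine Finset.sum_congr rfl fun σ _ => ?_
  rw [excitation_productState]
  refine Finset.sum_congr rfl fun j _ => ?_
  congr 2
  simp [orthonormal_iff_ite.1 hφ]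

theorem hasDerivAt_permanent {d M N : ℕ} {φ : Fin M → Orbital d} (hφ : Orthonormal ℂ φ)
    (g : Fin M → Orbital d) {n : Fin M → ℕ} (hn : n ∈ occupations M N) :
    HasDerivAt (fun z : ℂ => permanent N (φ + z • g) n)
      (excitation φ g N (permanent N φ n)) 0 := by
  obtain ⟨c, κ, h⟩ := exists_permanent_eq (d := d) hn
  simp only [h, map_smul]
  refine HasDerivAt.const_smul c ?_
  rw [excitation_symProd hφ]
  exact HasDerivAt.fun_sum fun σ _ =>
    hasDerivAt_productState N (fun i => φ (κ (σ i))) (fun i => g (κ (σ i)))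

theorem permanent_mem_oneBodyGraph {d M N : ℕ} {φ : Fin M → Orbital d} (hφ : Orthonormal ℂ φ)
    (a : Orbital d →ₗ.[ℂ] Orbital d) (ha : ∀ k, φ k ∈ a.domain) {n : Fin M → ℕ}
    (hn : n ∈ occupations M N) :
    (permanent N φ n, excitation φ (fun k => a ⟨φ k, ha k⟩) N (permanent N φ n)) ∈
      oneBodyGraph N a := by
  obtain ⟨c, κ, h⟩ := exists_permanent_eq (d := d) hn
  rw [h, map_smul, ← Prod.smul_mk]
  refine Submodule.smul_mem _ _ ?_
  rw [excitation_symProd hφ, symProd, prod_mk_sum]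
  exact Submodule.sum_mem _ fun σ _ => Submodule.subset_span ⟨fun i => ⟨φ (κ (σ i)), ha _⟩, rfl⟩

/-! ### The ansatz -/

theorem ansatz_mem_oneBodyGraph {d M N : ℕ} (C : (Fin M → ℕ) → ℂ) {φ : Fin M → Orbital d}
    (hφ : Orthonormal ℂ φ) (a : Orbital d →ₗ.[ℂ] Orbital d) (ha : ∀ k, φ k ∈ a.domain) :
    (ansatz N C φ, excitation φ (fun k => a ⟨φ k, ha k⟩) N (ansatz N C φ)) ∈
      oneBodyGraph N a := by
  simp only [ansatz, map_sum, map_smul, prod_mk_sum]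
  refine Submodule.sum_mem _ fun n hn => ?_
  rw [← Prod.smul_mk]
  exact Submodule.smul_mem _ _ (permanent_mem_oneBodyGraph hφ a ha hn)

theorem ansatz_mem_domain {d M N : ℕ} (C : (Fin M → ℕ) → ℂ) {φ : Fin M → Orbital d}
    (hφ : Orthonormal ℂ φ) (a : Orbital d →ₗ.[ℂ] Orbital d) (ha : ∀ k, φ k ∈ a.domain) :
    ansatz N C φ ∈ (oneBody N a).domain :=
  (applyOp_of_mem_graph _ ((oneBody_graph (N := N) a).symm ▸
    ansatz_mem_oneBodyGraph C hφ a ha)).1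

theorem applyOp_oneBody_ansatz {d M N : ℕ} (C : (Fin M → ℕ) → ℂ) {φ : Fin M → Orbital d}
    (hφ : Orthonormal ℂ φ) (a : Orbital d →ₗ.[ℂ] Orbital d) (ha : ∀ k, φ k ∈ a.domain) :
    applyOp (oneBody N a) (ansatz N C φ) =
      excitation φ (fun k => a ⟨φ k, ha k⟩) N (ansatz N C φ) :=
  (applyOp_of_mem_graph _ ((oneBody_graph (N := N) a).symm ▸
    ansatz_mem_oneBodyGraph C hφ a ha)).2

/-! ### One-body operators in second quantization -/

theorem sum_bDag_bAnn_ansatz {d M : ℕ} (φ g : Fin M → Orbital d) (C : (Fin M → ℕ) → ℂ) :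
    ∀ N : ℕ, ∑ k, bDag (g k) (bAnn (φ k) (Pi.single N (ansatz N C φ))) N =
      excitation φ g N (ansatz N C φ)
  | 0 => by simp [bDag, excitation]
  | N + 1 => by
    have h : ∀ n ∈ occupations M (N + 1),
        ∑ k, creation (g k) (annihilation (φ k) (permanent (N + 1) φ n)) =
          excitation φ g (N + 1) (permanent (N + 1) φ n) := by
      intro n hn
      obtain ⟨c, κ, h⟩ := exists_permanent_eq (d := d) hn
      simp only [h, map_smul]
      rw [← Finset.smul_sum, sum_creation_annihilation_symProd]
    have h1 : ∀ k, bDag (g k) (bAnn (φ k) (Pi.single (N + 1) (ansatz (N + 1) C φ))) (N + 1) =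
        creation (g k) (annihilation (φ k) (ansatz (N + 1) C φ)) := fun k => by
      simp [bDag, bAnn]
    simp only [h1]
    simp only [ansatz, map_sum, map_smul]
    rw [Finset.sum_comm]
    refine Finset.sum_congr rfl fun n hn => ?_
    rw [← Finset.smul_sum, h n hn]

/-- The bilinear map `(f, Ψ) ↦ b†(f)Ψ`. -/
noncomputable def creationL {d N : ℕ} :
    Orbital d →L[ℂ] WaveFun d N →L[ℂ] WaveFun d (N + 1) :=
  ((Real.sqrt (N + 1) : ℂ))⁻¹ • ∑ j : Fin (N + 1), insertL j

theorem creationL_apply {d N : ℕ} (f : Orbital d) : creationL (N := N) f = creation f := by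
  simp [creationL, creation, insertL_apply]

theorem hasSum_inner_smul_bDag {d N : ℕ} {ι : Type*} (e : HilbertBasis ι ℂ (Orbital d))
    (f : Orbital d) (F : Fock d) :
    HasSum (fun q => ⟪e q, f⟫_ℂ • bDag (e q) F N) (bDag f F N) := by
  cases N with
  | zero => simp [bDag]
  | succ N =>
    have h := (e.hasSum_repr f).mapL ((creationL (N := N)).flip (F N))
    simpa [creationL_apply, HilbertBasis.repr_apply_apply, bDag] using h

theorem hasSum_bDag_bAnn_ansatz {d M N : ℕ} {ι : Type*} (e : HilbertBasis ι ℂ (Orbital d))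
    (φ g : Fin M → Orbital d) (C : (Fin M → ℕ) → ℂ) :
    HasSum (fun q => ∑ k, ⟪e q, g k⟫_ℂ •
        bDag (e q) (bAnn (φ k) (Pi.single N (ansatz N C φ))) N)
      (excitation φ g N (ansatz N C φ)) := by
  rw [← sum_bDag_bAnn_ansatz]
  exact hasSum_sum fun k _ => hasSum_inner_smul_bDag e (g k) _

/-! ### The space of allowed variations -/

theorem hasDerivAt_ansatz {d M N : ℕ} (C δC : (Fin M → ℕ) → ℂ) {φ : Fin M → Orbital d}
    (hφ : Orthonormal ℂ φ) (δφ : Fin M → Orbital d) :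
    HasDerivAt (fun s : ℝ => ansatz N (C + s • δC) (φ + s • δφ))
      (ansatz N δC φ + excitation φ δφ N (ansatz N C φ)) 0 := by
  -- The ansatz is differentiated along a complex parameter, then restricted to the real line.
  have h : HasDerivAt (fun z : ℂ => ansatz N (C + z • δC) (φ + z • δφ))
      (ansatz N δC φ + excitation φ δφ N (ansatz N C φ)) ((0 : ℝ) : ℂ) := by
    rw [Complex.ofReal_zero]
    have h1 : ∀ n ∈ occupations M N,
        HasDerivAt (fun z : ℂ => (C + z • δC) n • permanent N (φ + z • δφ) n)
          (C n • excitation φ δφ N (permanent N φ n) + δC n • permanent N φ n) 0 := by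
      intro n hn
      have h2 : HasDerivAt (fun z : ℂ => (C + z • δC) n) (δC n) 0 := by
        simpa using ((hasDerivAt_id (0 : ℂ)).mul_const (δC n)).const_add (C n)
      simpa using h2.fun_smul (hasDerivAt_permanent hφ δφ hn)
    refine (HasDerivAt.fun_sum h1).congr_deriv ?_
    simp only [ansatz, map_sum, map_smul, Finset.sum_add_distrib]
    exact add_comm _ _
  have h' := h.scomp (0 : ℝ) Complex.ofRealCLM.hasDerivAt
  simp only [Complex.ofRealCLM_apply, Complex.ofReal_one, one_smul] at h'
  refine h'.congr_of_eventuallyEq (Filter.Eventually.of_forall fun s => ?_)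
  simp only [Function.comp_apply]
  congr 2

theorem mem_allowedVariations_iff {d M N : ℕ} {C : (Fin M → ℕ) → ℂ} {φ : Fin M → Orbital d}
    (hφ : Orthonormal ℂ φ) {Φ : WaveFun d N} :
    Φ ∈ allowedVariations N C φ ↔ ∃ (δC : (Fin M → ℕ) → ℂ) (δφ : Fin M → Orbital d),
      ansatz N δC φ + excitation φ δφ N (ansatz N C φ) = Φ :=
  exists_congr fun δC => exists_congr fun δφ =>
    ⟨fun h => (hasDerivAt_ansatz C δC hφ δφ).unique h,
      fun h => h ▸ hasDerivAt_ansatz C δC hφ δφ⟩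

theorem ansatz_zero {d M N : ℕ} (φ : Fin M → Orbital d) : ansatz N 0 φ = 0 := by
  simp [ansatz]

theorem excitation_zero {d M N : ℕ} (φ : Fin M → Orbital d) (Ψ : WaveFun d N) :
    excitation φ 0 N Ψ = 0 := by
  have h := excitation_smul φ 0 0 N Ψ
  rwa [zero_smul, zero_smul] at h

/-- The allowed variations as a linear space. -/
noncomputable def variationSpace {d M : ℕ} (N : ℕ) (C : (Fin M → ℕ) → ℂ)
    (φ : Fin M → Orbital d) : Submodule ℂ (WaveFun d N) where
  carrier := {Φ | ∃ (δC : (Fin M → ℕ) → ℂ) (δφ : Fin M → Orbital d),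
    ansatz N δC φ + excitation φ δφ N (ansatz N C φ) = Φ}
  zero_mem' := ⟨0, 0, by rw [ansatz_zero, excitation_zero, add_zero]⟩
  add_mem' := by
    rintro _ _ ⟨δC, δφ, rfl⟩ ⟨δC', δφ', rfl⟩
    refine ⟨δC + δC', δφ + δφ', ?_⟩
    rw [excitation_add]
    simp only [ansatz, Pi.add_apply, add_smul, Finset.sum_add_distrib]
    abel
  smul_mem' := by
    rintro c _ ⟨δC, δφ, rfl⟩
    refine ⟨c • δC, c • δφ, ?_⟩
    rw [excitation_smul, smul_add]
    simp only [ansatz, Pi.smul_apply, smul_eq_mul, Finset.smul_sum, smul_smul]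

theorem applyOp_mem_allowedVariations {d M N : ℕ} (C : (Fin M → ℕ) → ℂ) {φ : Fin M → Orbital d}
    (hφ : Orthonormal ℂ φ) (a : Orbital d →ₗ.[ℂ] Orbital d) (ha : ∀ k, φ k ∈ a.domain) :
    applyOp (oneBody N a) (ansatz N C φ) ∈ allowedVariations N C φ := by
  rw [mem_allowedVariations_iff hφ, applyOp_oneBody_ansatz C hφ a ha]
  exact ⟨0, _, by rw [ansatz_zero, zero_add]⟩

theorem allowedVariations_eq_span {d M N : ℕ} (C : (Fin M → ℕ) → ℂ) {φ : Fin M → Orbital d}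
    (hφ : Orthonormal ℂ φ) :
    allowedVariations N C φ =
      (Submodule.span ℂ
        ({Φ : WaveFun d N | ∃ n ∈ occupations M N, Φ = permanent N φ n} ∪
          {Φ : WaveFun d N | ∃ a : Orbital d →ₗ.[ℂ] Orbital d, (∀ k, φ k ∈ a.domain) ∧
            Φ = applyOp (oneBody N a) (ansatz N C φ)}) : Set (WaveFun d N)) := by
  classical
  have hV : allowedVariations N C φ = variationSpace N C φ :=
    Set.ext fun Φ => mem_allowedVariations_iff hφ
  refine Set.Subset.antisymm ?_ ?_
  · intro Φ hΦ
    obtain ⟨δC, δφ, rfl⟩ := (mem_allowedVariations_iff hφ).1 hΦ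
    refine Submodule.add_mem _ (Submodule.sum_mem _ fun n hn => Submodule.smul_mem _ _
      (Submodule.subset_span (Or.inl ⟨n, hn, rfl⟩))) (Submodule.subset_span (Or.inr ?_))
    -- The finite rank operator `∑ k, |δφ_k⟩⟨φ_k|`, which maps `φ_k` to `δφ_k` by orthonormality.
    let a : Orbital d →ₗ.[ℂ] Orbital d :=
      (∑ k, (innerSL ℂ (φ k)).smulRight (δφ k) : Orbital d →L[ℂ] Orbital d).toLinearMap.toPMap ⊤
    have ha : ∀ k, φ k ∈ a.domain := fun k => Submodule.mem_top
    refine ⟨a, ha, ?_⟩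
    rw [applyOp_oneBody_ansatz C hφ a ha]
    congr 2
    funext k
    simp [a, orthonormal_iff_ite.1 hφ]
  · rw [hV, SetLike.coe_subset_coe, Submodule.span_le, ← hV]
    rintro Φ (⟨n, hn, rfl⟩ | ⟨a, ha, rfl⟩)
    · rw [hV]
      refine ⟨Pi.single n 1, 0, ?_⟩
      rw [excitation_zero, add_zero, ansatz, Finset.sum_eq_single_of_mem n hn]
      · simp
      · intro m _ hm
        simp [Pi.single_eq_of_ne hm]
    · exact applyOp_mem_allowedVariations C hφ a ha

/-! ### Stationarity -/

theorem conj_energyForm {d N : ℕ} (V W : Pos d → ℝ) (g : ℝ) (Φ Ψ : WaveFun d N) :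
    starRingEnd ℂ (energyForm V W g Φ Ψ) = energyForm V W g Ψ Φ := by
  simp only [energyForm, map_add, map_mul, map_sum, ← integral_conj, inner_conj_symm,
    Complex.conj_ofReal, Complex.conj_conj]
  simp [mul_comm, Complex.conj_ofNat]

theorem inner_deriv_applyOp_add_eq_zero {d M N : ℕ} {V W : Pos d → ℝ} {g : ℝ}
    {C : (Fin M → ℕ) → ℂ} {φ : Fin M → Orbital d} {a : Orbital d →ₗ.[ℂ] Orbital d}
    (hφ : Orthonormal ℂ φ) (hcomm : CommutesWithH V W g (oneBody N a))
    (ha : ∀ k, φ k ∈ a.domain) (hΨ : InFormDomain V W g (ansatz N C φ))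
    (hA : InFormDomain V W g (applyOp (oneBody N a) (ansatz N C φ))) {Ψ' : WaveFun d N}
    (hDF : energyForm V W g (applyOp (oneBody N a) (ansatz N C φ)) (ansatz N C φ) -
      Complex.I * ⟪applyOp (oneBody N a) (ansatz N C φ), Ψ'⟫_ℂ = 0) :
    ⟪Ψ', applyOp (oneBody N a) (ansatz N C φ)⟫_ℂ +
      ⟪applyOp (oneBody N a) (ansatz N C φ), Ψ'⟫_ℂ = 0 := by
  have hdom := ansatz_mem_domain (N := N) C hφ a ha
  have hap : oneBody N a ⟨ansatz N C φ, hdom⟩ = applyOp (oneBody N a) (ansatz N C φ) := by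
    rw [applyOp, dif_pos hdom]
  have hc := hcomm ⟨_, hdom⟩ ⟨_, hdom⟩ hΨ hΨ (by rwa [hap]) (by rwa [hap])
  rw [hap] at hc
  have h1 := sub_eq_zero.1 hDF
  have h2 := conj_energyForm V W g (applyOp (oneBody N a) (ansatz N C φ)) (ansatz N C φ)
  rw [← hc, h1, map_mul, Complex.conj_I, inner_conj_symm] at h2
  -- `h2` now says that `i⟨AΨ|Ψ'⟩` equals its own conjugate `-i⟨Ψ'|AΨ⟩`.
  have h3 : Complex.I * (⟪Ψ', applyOp (oneBody N a) (ansatz N C φ)⟫_ℂ +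
      ⟪applyOp (oneBody N a) (ansatz N C φ), Ψ'⟫_ℂ) = 0 := by
    linear_combination -h2
  exact (mul_eq_zero.1 h3).resolve_left Complex.I_ne_zero

/-- For unbounded `A`, `v = AΨ` is only continuous, so the product rule is unavailable. Symmetry
turns the increment into `⟪u s - u t, v s⟫ + ⟪v t, u s - u t⟫`, where only `u` is differenced. -/
theorem hasDerivWithinAt_inner_of_symmetric {E : Type*} [NormedAddCommGroup E]
    [InnerProductSpace ℂ E] {I : Set ℝ} {u v : ℝ → E} {u' : E} {t : ℝ} (ht : t ∈ I)
    (hu : HasDerivWithinAt u u' I t) (hv : ContinuousWithinAt v I t)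
    (hsymm : ∀ s ∈ I, ⟪u t, v s⟫_ℂ = ⟪v t, u s⟫_ℂ) :
    HasDerivWithinAt (fun s => ⟪u s, v s⟫_ℂ) (⟪u', v t⟫_ℂ + ⟪v t, u'⟫_ℂ) I t := by
  rw [hasDerivWithinAt_iff_tendsto_slope] at hu ⊢
  have hv' : Filter.Tendsto v (nhdsWithin t (I \ {t})) (nhds (v t)) :=
    hv.mono_left (nhdsWithin_mono _ Set.sdiff_subset)
  have h := (hu.inner (𝕜 := ℂ) hv').add ((tendsto_const_nhds (x := v t)).inner (𝕜 := ℂ) hu)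
  refine h.congr' ?_
  filter_upwards [self_mem_nhdsWithin] with s hs
  have h1 : ⟪u t, v t⟫_ℂ = ⟪v t, u t⟫_ℂ := hsymm t ht
  simp only [slope_def_module, inner_smul_left_eq_smul, inner_smul_right_eq_smul, inner_sub_left,
    inner_sub_right, ← smul_add, hsymm s hs.1, h1]
  congr 1
  ring

theorem expectation_stationary {d N M : ℕ} {V W : Pos d → ℝ} {g : ℝ} {I : Set ℝ}
    {C : ℝ → (Fin M → ℕ) → ℂ} {φ : ℝ → Fin M → Orbital d} {a : Orbital d →ₗ.[ℂ] Orbital d}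
    (hφ : ∀ t ∈ I, Orthonormal ℂ (φ t)) (hDF : DiracFrenkel N V W g I C φ)
    (ha : a.IsFormalAdjoint a) (hcomm : CommutesWithH V W g (oneBody N a))
    (hdom : ∀ t ∈ I, ∀ k, φ t k ∈ a.domain)
    (hA : ∀ t ∈ I, InFormDomain V W g (applyOp (oneBody N a) (ansatz N (C t) (φ t))))
    (hcont : ContinuousOn (fun t => applyOp (oneBody N a) (ansatz N (C t) (φ t))) I)
    {t : ℝ} (ht : t ∈ I) :
    HasDerivWithinAt (fun s => expectation (oneBody N a) (ansatz N (C s) (φ s))) 0 I t := by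
  obtain ⟨hΨ, Ψ', hd, hv⟩ := hDF t ht
  have h0 := inner_deriv_applyOp_add_eq_zero (hφ t ht) hcomm (hdom t ht) hΨ (hA t ht)
    (hv _ (applyOp_mem_allowedVariations (C t) (hφ t ht) a (hdom t ht)) (hA t ht))
  refine (hasDerivWithinAt_inner_of_symmetric ht hd (hcont t ht) fun s hs => ?_).congr_deriv h0
  have hs' := ansatz_mem_domain (N := N) (C s) (hφ s hs) a (hdom s hs)
  have ht' := ansatz_mem_domain (N := N) (C t) (hφ t ht) a (hdom t ht)
  simp only [applyOp, dif_pos hs', dif_pos ht']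
  exact (isFormalAdjoint_oneBody ha ⟨_, ht'⟩ ⟨_, hs'⟩).symm
-- The main theorem
theorem mainTheorem4 (d N M : ℕ) :
    -- the space of allowed variations
    (∀ (C : (Fin M → ℕ) → ℂ) (φ : Fin M → Orbital d), Orthonormal ℂ φ →
      allowedVariations N C φ =
        (Submodule.span ℂ
          ({Φ : WaveFun d N | ∃ n ∈ occupations M N, Φ = permanent N φ n} ∪
            {Φ : WaveFun d N | ∃ a : Orbital d →ₗ.[ℂ] Orbital d, (∀ k, φ k ∈ a.domain) ∧
              Φ = applyOp (oneBody N a) (ansatz N C φ)}) : Set (WaveFun d N))) ∧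
    -- the one-body operators in second quantization, `A = ∑_{qk} a_{qk} b_q† b_k`
    (∀ (C : (Fin M → ℕ) → ℂ) (φ : Fin M → Orbital d), Orthonormal ℂ φ →
      ∀ (a : Orbital d →ₗ.[ℂ] Orbital d) (ha : ∀ k, φ k ∈ a.domain),
        ansatz N C φ ∈ (oneBody N a).domain ∧
        ∀ (ι : Type) (e : HilbertBasis ι ℂ (Orbital d)),
          HasSum (fun q : ι => ∑ k : Fin M, ⟪e q, a ⟨φ k, ha k⟩⟫_ℂ •
              bDag (e q) (bAnn (φ k) (Pi.single N (ansatz N C φ))) N)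
            (applyOp (oneBody N a) (ansatz N C φ))) ∧
    -- one-body observables that commute with `H` have stationary expectation values
    (∀ (V W : Pos d → ℝ) (g : ℝ) (I : Set ℝ) (C : ℝ → (Fin M → ℕ) → ℂ)
        (φ : ℝ → Fin M → Orbital d) (a : Orbital d →ₗ.[ℂ] Orbital d),
      I.OrdConnected →
      (∀ t ∈ I, Orthonormal ℂ (φ t)) →
      DiracFrenkel N V W g I C φ →
      a.IsFormalAdjoint a →
      CommutesWithH V W g (oneBody N a) →
      (∀ t ∈ I, ∀ k, φ t k ∈ a.domain) →
      (∀ t ∈ I, InFormDomain V W g (applyOp (oneBody N a) (ansatz N (C t) (φ t)))) →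
      ContinuousOn (fun t => applyOp (oneBody N a) (ansatz N (C t) (φ t))) I →
      (∀ t ∈ I, HasDerivWithinAt
        (fun s => expectation (oneBody N a) (ansatz N (C s) (φ s))) 0 I t) ∧
      ∀ s ∈ I, ∀ t ∈ I, expectation (oneBody N a) (ansatz N (C s) (φ s)) =
        expectation (oneBody N a) (ansatz N (C t) (φ t))) := by
  refine ⟨fun C φ hφ => allowedVariations_eq_span C hφ, fun C φ hφ a ha =>
    ⟨ansatz_mem_domain C hφ a ha, fun ι e => ?_⟩, ?_⟩
  · rw [applyOp_oneBody_ansatz C hφ a ha]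
    exact hasSum_bDag_bAnn_ansatz e φ _ C
  · intro V W g I C φ a hI hφ hDF ha hcomm hdom hA hcont
    have h : ∀ t ∈ I, HasDerivWithinAt
        (fun s => expectation (oneBody N a) (ansatz N (C s) (φ s))) 0 I t :=
      fun t ht => expectation_stationary hφ hDF ha hcomm hdom hA hcont ht
    refine ⟨h, fun s hs t ht => ?_⟩
    -- Mean value inequality with derivative bound `0` on the convex set `I`.
    have := Convex.norm_image_sub_le_of_norm_hasDerivWithin_le (C := 0) h
      (fun _ _ => norm_zero.le) hI.convex ht hs
    rw [zero_mul] at this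
    exact sub_eq_zero.1 (norm_le_zero_iff.1 this)
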